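/- Let $G$ be a group. For $g,h\in G$, a subset $E\subseteq G$ is called a weak Sierpiński subset with respect to $(g,h)$ if there are elements $a\neq b$ of $E$ with $gE=E\smallsetminus\{a\}$ and $hE=E\smallsetminus\{b\}$; it is called a weak Sierpiński subset if this holds for some $g,h\in G$. (i) If $G$ contains a weak Sierpiński subset, then $G$ contains a free subgroup of rank two. (ii) More precisely, if $G$ contains a weak Sierpiński subset with respect to $(g,h)$, then $(g,\,h^{-1}gh)$ is a free pair in the subgroup $H=\langle g,h\rangle$; that is, the homomorphism from the free group on two letters $x,y$ to $H$ with $x\mapsto g$ and $y\mapsto h^{-1}gh$ is injective. -/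

import Mathlib

open scoped Pointwise

/-- `E` is a weak Sierpiński subset of `G` with respect to `g` and `h`: there are distinct points
`a, b` of `E` with `gE = E ∖ {a}` and `hE = E ∖ {b}`. Here `g • E` is the left translate `gE`. -/
def IsWeakSierpinskiWith {G : Type*} [Group G] (g h : G) (E : Set G) : Prop :=
  ∃ a ∈ E, ∃ b ∈ E, a ≠ b ∧ g • E = E \ {a} ∧ h • E = E \ {b}

/-- `E` is a weak Sierpiński subset of `G`. -/
def IsWeakSierpinski {G : Type*} [Group G] (E : Set G) : Prop :=
  ∃ g h : G, IsWeakSierpinskiWith g h E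

/-- `(x, y)` is a free pair: the homomorphism from the free group on two letters that sends the
letters to `x` and `y` is injective, so `x` and `y` freely generate the subgroup `⟨x, y⟩`. -/
def IsFreePair {G : Type*} [Group G] (x y : G) : Prop :=
  Function.Injective (FreeGroup.lift (![x, y] : Fin 2 → G))

/-- A subgroup that is free of rank two. -/
def IsFreeOfRankTwo {G : Type*} [Group G] (F : Subgroup G) : Prop :=
  Nonempty (F ≃* FreeGroup (Fin 2))

/-- The first generator `g`, as an element of the subgroup `⟨g, h⟩`. -/
def fstGen {G : Type*} [Group G] (g h : G) : Subgroup.closure ({g, h} : Set G) :=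
  ⟨g, Subgroup.subset_closure (Set.mem_insert g {h})⟩

/-- The second generator `h`, as an element of the subgroup `⟨g, h⟩`. -/
def sndGen {G : Type*} [Group G] (g h : G) : Subgroup.closure ({g, h} : Set G) :=
  ⟨h, Subgroup.subset_closure (Set.mem_insert_of_mem g (Set.mem_singleton h))⟩

/-! Draw an edge from `x` to `c * x` for each generator `c`. A weak Sierpiński set `E` is then a cut
with two boundary edges, both entering `E`: a `g`-edge at `a` and an `h`-edge at `b`. If `(g, h)` is
a free pair, the conclusion is a fact about free groups (`IsFreePair.conj`).

Otherwise a shortest nontrivial relation is a loop crossing the cut. It enters `E` at one of `a`,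
`b` and must leave at the other. Minimality makes the shorter of its two arcs unique, and comparing
rotations of the loop forces that arc to be periodic, so `b` lies in the orbit of `a` under `t = g *
h⁻¹` (`IsEdgeCut.exists_zpow`).

Adding suitable right translates to `E`, based at `a`, then gives a `t`-invariant set whose only
boundary edge is a `g`-edge (`isFreePair_conj_of_zpow`). Ping-pong with its translates makes `(g, t
* g * t⁻¹)` free, and conjugating by `g⁻¹` gives `(g, h⁻¹ * g * h)`. -/

/-! ### Ping-pong from a cut with a single boundary edge -/

/-- A subset that misses `1` and is invariant under left translation by generators is empty. -/
theorem notMem_of_leftInvariant {G : Type*} [Group G] {g t : G}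
    (hcl : Subgroup.closure ({g, t} : Set G) = ⊤) (W : Set G)
    (hg : ∀ x, g * x ∈ W ↔ x ∈ W) (ht : ∀ x, t * x ∈ W ↔ x ∈ W) (h1 : 1 ∉ W) (x : G) : x ∉ W := by
  have key : ∀ x ∈ Subgroup.closure ({g, t} : Set G), ∀ y, x * y ∈ W ↔ y ∈ W := by
    intro x hx
    induction hx using Subgroup.closure_induction with
    | mem x hx =>
      rcases hx with rfl | rfl
      exacts [hg, ht]
    | one => simp
    | mul x y _ _ ihx ihy => intro z; rw [mul_assoc, ihx, ihy]
    | inv x _ ih => intro z; rw [← ih, mul_inv_cancel_left]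
  have := key x (hcl ▸ Subgroup.mem_top x) 1
  rw [mul_one] at this
  exact fun hx => h1 (this.1 hx)

/-- Ping-pong for a group generated by `g` and `t` with a set `Y` whose only boundary edge in the
Cayley graph is the `g`-edge ending at `1`. -/
theorem isFreePair_conj_of_closure_eq_top {G : Type*} [Group G] {g t : G}
    (hcl : Subgroup.closure ({g, t} : Set G) = ⊤) (ht1 : t ≠ 1) (Y : Set G) (h1 : 1 ∈ Y)
    (hg : ∀ x, x ∈ Y ↔ g * x ∈ Y ∧ g * x ≠ 1) (ht : ∀ x, t * x ∈ Y ↔ x ∈ Y) :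
    IsFreePair g (t * g * t⁻¹) := by
  have hg' : ∀ y, g * y ∈ Y ↔ y ∈ Y ∨ y = g⁻¹ := by
    intro y
    constructor
    · intro h
      by_cases hy : g * y = 1
      · exact Or.inr (eq_inv_of_mul_eq_one_right hy)
      · exact Or.inl ((hg y).2 ⟨h, hy⟩)
    · rintro (h | rfl)
      · exact ((hg y).1 h).1
      · simpa using h1
  have hpos : ∀ x ∈ Y, g * x ∈ Y := fun x hx => ((hg x).1 hx).1
  have hginv : g⁻¹ ∉ Y := fun h => ((hg _).1 h).2 (mul_inv_cancel g)
  have htm : t ∈ Y := by simpa using (ht 1).2 h1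
  have htinv : t⁻¹ ∈ Y := (ht _).1 (by simpa using h1)
  have htg : t * g⁻¹ ∉ Y := fun h => hginv ((ht _).1 h)
  have htig : t⁻¹ * g⁻¹ ∉ Y := fun h => hginv (by simpa using (ht _).2 h)
  have hback : ∀ x ∉ Y, g⁻¹ * x ∉ Y := fun x hx h => hx (by simpa using hpos _ h)
  have hfwd : ∀ x ∈ Y, x ≠ 1 → g⁻¹ * x ∈ Y := fun x hx h =>
    (hg _).2 ⟨by simpa using hx, by simpa using h⟩
  -- the four ping-pong sets, after inversion, are pairwise disjoint
  have d1 : ∀ x, ¬ (x ∉ Y ∧ x * t ∉ Y) := by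
    -- Each of the two conditions changes across only one edge, and by `p` and `q` the other
    -- condition fails at both ends of it; hence their conjunction never changes along an edge. The
    -- same pattern gives `d2` to `d5`.
    refine notMem_of_leftInvariant hcl {x | x ∉ Y ∧ x * t ∉ Y} (fun x => ?_)
      (fun x => by simp [mul_assoc, ht]) (by simp [h1])
    have p : x = g⁻¹ → x * t ∈ Y := by rintro rfl; exact hfwd _ htm ht1
    have q : x * t = g⁻¹ → x ∈ Y := by
      intro h; rw [eq_mul_inv_of_mul_eq h]; exact hfwd _ htinv (inv_ne_one.2 ht1)
    simp only [Set.mem_ofPred_eq, mul_assoc, hg']; tauto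
  have d2 : ∀ x, ¬ (x * g⁻¹ ∈ Y ∧ x * (t * g⁻¹) ∈ Y) := by
    refine notMem_of_leftInvariant hcl {x | x * g⁻¹ ∈ Y ∧ x * (t * g⁻¹) ∈ Y} (fun x => ?_)
      (fun x => by simp [mul_assoc, ht]) (by simp [hginv])
    have p : x * g⁻¹ = g⁻¹ → x * (t * g⁻¹) ∉ Y ∧ x * (t * g⁻¹) ≠ g⁻¹ := by
      intro h; obtain rfl : x = 1 := by simpa using h
      simpa using ⟨htg, ht1⟩
    have q : x * (t * g⁻¹) = g⁻¹ → x * g⁻¹ ∉ Y := by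
      intro h
      obtain rfl : x = t⁻¹ := by
        rw [← mul_assoc] at h; exact eq_inv_of_mul_eq_one_left (by simpa using h)
      exact htig
    simp only [Set.mem_ofPred_eq, mul_assoc, hg']; tauto
  have d3 : ∀ x, ¬ (x * g⁻¹ ∈ Y ∧ x ∉ Y) := by
    refine notMem_of_leftInvariant hcl {x | x * g⁻¹ ∈ Y ∧ x ∉ Y} (fun x => ?_)
      (fun x => by simp [mul_assoc, ht]) (by simp [h1])
    have p : x * g⁻¹ = g⁻¹ → x ∈ Y := by
      intro h; obtain rfl : x = 1 := by simpa using h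
      exact h1
    have q : x = g⁻¹ → x * g⁻¹ ∉ Y := by rintro rfl; exact hback _ hginv
    simp only [Set.mem_ofPred_eq, mul_assoc, hg']; tauto
  have d4 : ∀ x, ¬ (x * g⁻¹ ∈ Y ∧ x * t ∉ Y) := by
    refine notMem_of_leftInvariant hcl {x | x * g⁻¹ ∈ Y ∧ x * t ∉ Y} (fun x => ?_)
      (fun x => by simp [mul_assoc, ht]) (by simp [hginv])
    have p : x * g⁻¹ = g⁻¹ → x * t ∈ Y := by
      intro h; obtain rfl : x = 1 := by simpa using h
      simpa using htm
    have q : x * t = g⁻¹ → x * g⁻¹ ∉ Y := by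
      intro h; rw [eq_mul_inv_of_mul_eq h, mul_assoc]; exact hback _ htig
    simp only [Set.mem_ofPred_eq, mul_assoc, hg']; tauto
  have d5 : ∀ x, ¬ (x * (t * g⁻¹) ∈ Y ∧ x ∉ Y) := by
    refine notMem_of_leftInvariant hcl {x | x * (t * g⁻¹) ∈ Y ∧ x ∉ Y} (fun x => ?_)
      (fun x => by simp [mul_assoc, ht]) (by simp [h1])
    have p : x * (t * g⁻¹) = g⁻¹ → x ∈ Y := by
      intro h
      obtain rfl : x = t⁻¹ := by
        rw [← mul_assoc] at h; exact eq_inv_of_mul_eq_one_left (by simpa using h)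
      exact htinv
    have q : x = g⁻¹ → x * (t * g⁻¹) ∉ Y := by rintro rfl; exact hback _ htg
    simp only [Set.mem_ofPred_eq, mul_assoc, hg']; tauto
  let c : Fin 2 → G := ![1, t]
  -- With these sets, `gen i * x ∈ A i` holds exactly when `x ∉ B i`, so the mapping conditions of
  -- ping-pong are immediate and only disjointness needs `d1` to `d5`.
  let A : ULift (Fin 2) → Set G := fun i => {x | x⁻¹ * c i.down ∉ Y}
  let B : ULift (Fin 2) → Set G := fun i => {x | x⁻¹ * (c i.down * g⁻¹) ∈ Y}
  let gen : ULift (Fin 2) → G := fun i => c i.down * g * (c i.down)⁻¹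
  have hinj : Function.Injective (FreeGroup.lift gen) := by
    refine FreeGroup.injective_lift_of_ping_pong gen A B ?_ ?_ ?_ ?_ ?_ ?_
    · rintro ⟨i⟩
      exact ⟨c i * g, by simp [A, hginv]⟩
    · rintro ⟨i⟩ ⟨j⟩ hij
      refine Set.disjoint_left.2 fun x hx hx' => ?_
      have e1 := d1 x⁻¹
      fin_cases i <;> fin_cases j <;> simp [A, c] at hij hx hx' <;> tauto
    · rintro ⟨i⟩ ⟨j⟩ hij
      refine Set.disjoint_left.2 fun x hx hx' => ?_
      have e2 := d2 x⁻¹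
      fin_cases i <;> fin_cases j <;> simp [B, c] at hij hx hx' <;> tauto
    · rintro ⟨i⟩ ⟨j⟩
      refine Set.disjoint_left.2 fun x hx hx' => ?_
      have e3 := d3 x⁻¹
      have e3' := d3 (x⁻¹ * t)
      have e4 := d4 x⁻¹
      have e5 := d5 x⁻¹
      simp only [mul_assoc] at e3'
      fin_cases i <;> fin_cases j <;> simp [A, B, c] at hx hx' <;> tauto
    · rintro i _ ⟨x, hx, rfl⟩
      simpa [A, B, gen, mul_assoc] using hx
    · rintro i _ ⟨x, hx, rfl⟩
      simpa [A, B, gen, mul_assoc] using hx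
  have hmap := FreeGroup.map_injective (f := (ULift.up : Fin 2 → ULift (Fin 2)))
    ULift.up_injective
  have hcomp : FreeGroup.lift (![g, t * g * t⁻¹] : Fin 2 → G) =
      (FreeGroup.lift gen).comp (FreeGroup.map ULift.up) := by
    ext i
    fin_cases i <;> simp [gen, c]
  rw [IsFreePair, hcomp]
  exact hinj.comp hmap

/-! ### Free pairs under homomorphisms and conjugation -/

theorem isFreePair_of_map {G H : Type*} [Group G] [Group H] (f : G →* H) {x y : G}
    (h : IsFreePair (f x) (f y)) : IsFreePair x y := by
  have hcomp : FreeGroup.lift (![f x, f y] : Fin 2 → H) =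
      f.comp (FreeGroup.lift (![x, y] : Fin 2 → G)) := by
    ext i
    fin_cases i <;> simp
  rw [IsFreePair, hcomp] at h
  exact Function.Injective.of_comp (f := f) h

theorem IsFreePair.map {G H : Type*} [Group G] [Group H] {f : G →* H}
    (hf : Function.Injective f) {x y : G} (h : IsFreePair x y) : IsFreePair (f x) (f y) := by
  have hcomp : FreeGroup.lift (![f x, f y] : Fin 2 → H) =
      f.comp (FreeGroup.lift (![x, y] : Fin 2 → G)) := by
    ext i
    fin_cases i <;> simp
  rw [IsFreePair, hcomp]
  exact hf.comp h

/-- If `tY = Y` and `gY = Y ∖ {a}` with `a ∈ Y` and `t ≠ 1`, then `g` and its conjugate by `t`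
are a free pair. -/
theorem isFreePair_conj_of_leftInvariant {G : Type*} [Group G] {g t a : G} (ht1 : t ≠ 1)
    (Y : Set G) (ha : a ∈ Y) (hg : ∀ x, x ∈ Y ↔ g * x ∈ Y ∧ g * x ≠ a)
    (ht : ∀ x, t * x ∈ Y ↔ x ∈ Y) : IsFreePair g (t * g * t⁻¹) := by
  -- Pass to the subgroup generated by `g` and `t`, and pull `Y` back along `x ↦ x * a`, which moves
  -- the base point to `1`.
  let K := Subgroup.closure ({g, t} : Set G)
  let g' : K := fstGen g t
  let t' : K := sndGen g t
  have hcl : Subgroup.closure ({g', t'} : Set K) = ⊤ := by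
    have := Subgroup.closure_closure_coe_preimage (k := ({g, t} : Set G))
    convert this using 2
    ext x
    simp [g', t', fstGen, sndGen, Subtype.ext_iff]
  have := isFreePair_conj_of_closure_eq_top hcl (t := t')
    (fun h => ht1 (congrArg Subtype.val h)) {x : K | (x : G) * a ∈ Y} (by simpa using ha)
    (fun x => by
      have := hg (x * a)
      rw [← mul_assoc, Ne, mul_eq_right] at this
      simpa [g', fstGen, Subtype.ext_iff] using this)
    (fun x => by simpa [t', sndGen, mul_assoc] using ht (x * a))
  exact this.map (f := K.subtype) K.subtype_injective

/-- In a group where `g` and `h` are a free pair, so are `g` and `h⁻¹gh`. -/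
theorem IsFreePair.conj {G : Type*} [Group G] {g h : G} (hf : IsFreePair g h) :
    IsFreePair g (h⁻¹ * g * h) := by
  let x : FreeGroup (Fin 2) := FreeGroup.of 0
  let y : FreeGroup (Fin 2) := FreeGroup.of 1
  suffices hxy : IsFreePair x (y⁻¹ * x * y) by
    simpa [x, y] using IsFreePair.map (f := FreeGroup.lift (![g, h] : Fin 2 → G)) hf hxy
  -- Let `ℤ` shift the letters of `FreeGroup ℤ`. Sending `y` to `-1` makes conjugation by `y⁻¹` a
  -- shift by `+1`, so `x` and `y⁻¹ * x * y` go to distinct free letters.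
  let shift : Multiplicative ℤ →* MulAut (FreeGroup ℤ) :=
    zpowersHom (MulAut (FreeGroup ℤ)) (FreeGroup.freeGroupCongr (Equiv.addRight (1 : ℤ)))
  let f : FreeGroup (Fin 2) →* FreeGroup ℤ ⋊[shift] Multiplicative ℤ := FreeGroup.lift
    ![SemidirectProduct.inl (FreeGroup.of 0), SemidirectProduct.inr (Multiplicative.ofAdd (-1))]
  refine isFreePair_of_map f ?_
  have e1 : f x = SemidirectProduct.inl (FreeGroup.of 0) := by simp [f, x]
  have e2 : f (y⁻¹ * x * y) = SemidirectProduct.inl (FreeGroup.of 1) := by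
    have : f y = SemidirectProduct.inr (Multiplicative.ofAdd (-1)) := by simp [f, y]
    rw [map_mul, map_mul, map_inv, e1, this]
    have := SemidirectProduct.inl_aut (φ := shift) (Multiplicative.ofAdd 1) (FreeGroup.of 0)
    simp [shift] at this
    simpa using this.symm
  rw [e1, e2]
  refine IsFreePair.map SemidirectProduct.inl_injective ?_
  have hcomp : FreeGroup.lift (![FreeGroup.of 0, FreeGroup.of 1] : Fin 2 → FreeGroup ℤ) =
      FreeGroup.map (fun i : Fin 2 => (i : ℤ)) := by
    ext i
    fin_cases i <;> simp
  rw [IsFreePair, hcomp]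
  exact FreeGroup.map_injective (fun i j h => by simpa [Fin.ext_iff] using h)

/-! ### Closing the cut under `t` -/

/-- Suppose `E` has one incoming `g`-edge, at `1`, and one incoming `t`-edge, at `1`, and one
outgoing `t`-edge, at a power of `t`. Then `g` and its conjugate by `t` are a free pair. -/
theorem isFreePair_conj_of_zpow {G : Type*} [Group G] {g t : G} {j : ℤ} (E : Set G)
    (h1 : 1 ∈ E) (hj : t ^ j ∈ E) (hg : ∀ x, x ∈ E ↔ g * x ∈ E ∧ g * x ≠ 1)
    (hin : ∀ x, t * x ∈ E → t * x ≠ 1 → x ∈ E)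
    (hout : ∀ x ∈ E, x ≠ t ^ j → t * x ∈ E ∧ t * x ≠ 1)
    (hne : t * t ^ j ∉ E) (ht : t ∈ E) (ht1 : t ≠ 1) :
    IsFreePair g (t * g * t⁻¹) := by
  have hzin : ∀ n : ℤ, t ^ n ∉ E → t ^ (n + 1) ∈ E → t ^ (n + 1) = 1 := by
    intro n hn hn1
    by_contra h
    rw [add_comm, zpow_one_add] at hn1 h
    exact hn (hin _ hn1 h)
  have hzout : ∀ n : ℤ, t ^ n ∉ E → t ^ (n - 1) ∈ E → t ^ (n - 1) = t ^ j := by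
    intro n hn hn1
    by_contra h
    have := (hout _ hn1 h).1
    rw [← zpow_one_add, add_sub_cancel] at this
    exact hn this
  have htinv : t⁻¹ ∉ E := by
    intro h
    by_cases h' : t⁻¹ = t ^ j
    · exact hne (by rw [← h']; simpa using h1)
    · exact (hout _ h h').2 (mul_inv_cancel t)
  -- The union of `E` with the translates `E * t ^ (-n)` that miss `1`; missing `1` keeps `g⁻¹` out
  -- of `Y`. All boundary edges of these translates sit at powers of `t`, and each unwanted one is
  -- absorbed by another member of the union: a neighbouring index for a translate, `1 + j` or `-1`
  -- for the `t`-edges of `E`.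
  let Y : Set G := {x | x ∈ E ∨ ∃ n : ℤ, t ^ n ∉ E ∧ x * t ^ n ∈ E}
  refine isFreePair_conj_of_leftInvariant ht1 Y (a := 1) (Or.inl h1) (fun x => ⟨?_, ?_⟩)
    (fun x => ⟨?_, ?_⟩)
  · rintro (hx | ⟨n, hn, hx⟩)
    · exact ⟨Or.inl ((hg x).1 hx).1, ((hg x).1 hx).2⟩
    · have := ((hg _).1 hx).1
      rw [← mul_assoc] at this
      refine ⟨Or.inr ⟨n, hn, this⟩, fun h => hn ?_⟩
      rwa [h, one_mul] at this
  · rintro ⟨hx | ⟨n, hn, hx⟩, hx1⟩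
    · exact Or.inl ((hg x).2 ⟨hx, hx1⟩)
    · by_cases h : g * x * t ^ n = 1
      · have e : g * x * t ^ (n + 1) = t := by rw [zpow_add_one, ← mul_assoc, h, one_mul]
        by_cases hn1 : t ^ (n + 1) ∈ E
        · rw [hzin n hn hn1, mul_one] at e
          exact Or.inl ((hg x).2 ⟨e ▸ ht, hx1⟩)
        · rw [mul_assoc] at e
          exact Or.inr ⟨n + 1, hn1, (hg _).2 ⟨by rwa [e], by rwa [e]⟩⟩
      · rw [mul_assoc] at h hx
        exact Or.inr ⟨n, hn, (hg _).2 ⟨hx, h⟩⟩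
  · rintro (hx | ⟨n, hn, hx⟩)
    · by_cases h : t * x = 1
      · obtain rfl := eq_inv_of_mul_eq_one_right h
        refine Or.inr ⟨1 + j, by rwa [zpow_one_add], ?_⟩
        rw [zpow_one_add, inv_mul_cancel_left]
        exact hj
      · exact Or.inl (hin x hx h)
    · by_cases h : t * x * t ^ n = 1
      · have e : x * t ^ (n + 1) = 1 := by
          rw [mul_assoc] at h
          rw [zpow_add_one, ← mul_assoc, eq_inv_of_mul_eq_one_right h, inv_mul_cancel]
        by_cases hn1 : t ^ (n + 1) ∈ E
        · rw [hzin n hn hn1, mul_one] at e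
          exact Or.inl (e ▸ h1)
        · exact Or.inr ⟨n + 1, hn1, e ▸ h1⟩
      · rw [mul_assoc] at h hx
        exact Or.inr ⟨n, hn, hin _ hx h⟩
  · rintro (hx | ⟨n, hn, hx⟩)
    · by_cases h : x = t ^ j
      · refine Or.inr ⟨-1, by simpa using htinv, ?_⟩
        rw [h, ← zpow_one_add, ← zpow_add, show 1 + j + -1 = j by ring]
        exact hj
      · exact Or.inl (hout x hx h).1
    · by_cases h : x * t ^ n = t ^ j
      · have e : t * x * t ^ (n - 1) = t ^ j := by
          rw [eq_mul_inv_of_mul_eq h, ← zpow_neg, ← zpow_add, ← zpow_one_add, ← zpow_add]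
          congr 1
          ring
        by_cases hn1 : t ^ (n - 1) ∈ E
        · rw [hzout n hn hn1, mul_eq_right] at e
          exact Or.inl (e ▸ h1)
        · exact Or.inr ⟨n - 1, hn1, e ▸ hj⟩
      · have := (hout _ hx h).1
        rw [← mul_assoc] at this
        exact Or.inr ⟨n, hn, this⟩

/-- The conclusion holds when `b` lies in the orbit of `a` under `gh⁻¹`. -/
theorem isFreePair_conj_of_mem_orbit {G : Type*} [Group G] {g h a b : G} {E : Set G}
    (ha : a ∈ E) (hb : b ∈ E) (hab : a ≠ b) (hg : ∀ x, x ∈ E ↔ g * x ∈ E ∧ g * x ≠ a)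
    (hh : ∀ x, x ∈ E ↔ h * x ∈ E ∧ h * x ≠ b) {j : ℤ} (hj : (g * h⁻¹) ^ j * a = b) :
    IsFreePair g (h⁻¹ * g * h) := by
  set t := g * h⁻¹ with ht
  have hin : ∀ x, t * x ∈ E → t * x ≠ a → x ∈ E := by
    intro x hx hxa
    rw [ht, mul_assoc] at hx hxa
    simpa using ((hh _).1 ((hg _).2 ⟨hx, hxa⟩)).1
  have hout : ∀ x ∈ E, x ≠ b → t * x ∈ E ∧ t * x ≠ a := by
    intro x hx hxb
    rw [ht, mul_assoc]
    exact (hg _).1 ((hh _).2 (by simpa using ⟨hx, hxb⟩))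
  have hb' : t * b ∈ E → t * b = a := by
    intro h1
    by_contra h2
    rw [ht, mul_assoc] at h1 h2
    exact ((hh _).1 ((hg _).2 ⟨h1, h2⟩)).2 (by simp)
  have ht1 : t ≠ 1 := by
    rintro h
    simpa [h] using (hout a ha hab).2
  have key : IsFreePair g (t * g * t⁻¹) := by
    by_cases htb : t * b = a
    -- The incoming and outgoing `t`-edges coincide, so `E` is already `t`-invariant.
    · refine isFreePair_conj_of_leftInvariant ht1 E ha hg (fun x => ⟨fun hx => ?_, fun hx => ?_⟩)
      · by_cases hxa : t * x = a
        · rwa [mul_left_cancel (hxa.trans htb.symm)]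
        · exact hin x hx hxa
      · by_cases hxb : x = b
        · rwa [hxb, htb]
        · exact (hout x hx hxb).1
    · refine isFreePair_conj_of_zpow (j := j) {x | x * a ∈ E} ?_ ?_ ?_ ?_ ?_ ?_ ?_ ht1
      · simpa using ha
      · simpa [hj] using hb
      · intro x
        have := hg (x * a)
        rwa [← mul_assoc, Ne, mul_eq_right] at this
      · intro x hx hx1
        have := hin (x * a)
        rw [← mul_assoc, Ne, mul_eq_right] at this
        exact this hx hx1
      · intro x hx hxj
        have := hout (x * a) hx (fun e => hxj (mul_right_cancel (e.trans hj.symm)))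
        rwa [← mul_assoc, Ne, mul_eq_right] at this
      · intro h'
        have h' : t * t ^ j * a ∈ E := h'
        rw [mul_assoc, hj] at h'
        exact htb (hb' h')
      · exact (hout a ha hab).1
  -- Conjugation by `g⁻¹` fixes `g` and, as `g⁻¹ * t = h⁻¹`, turns `t * g * t⁻¹` into `h⁻¹ * g * h`.
  have := key.map (f := (MulAut.conj g⁻¹).toMonoidHom) (MulAut.conj g⁻¹).injective
  simpa [ht, mul_assoc] using this

/-! ### Words and shortest relations -/

namespace FreeGroup

variable {α G : Type*} [Group G]

/-- The value of a word under an assignment of group elements to the letters. -/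
def wordValue (f : α → G) (w : List (α × Bool)) : G := lift f (mk w)

section wordValue

variable (f : α → G)

theorem wordValue_append (u v : List (α × Bool)) :
    wordValue f (u ++ v) = wordValue f u * wordValue f v := by
  simp [wordValue, ← mul_mk]

@[simp] theorem wordValue_nil : wordValue f [] = 1 := by simp [wordValue]

theorem wordValue_cons_true (k : α) (w : List (α × Bool)) :
    wordValue f ((k, true) :: w) = f k * wordValue f w := by simp [wordValue]

theorem wordValue_cons_false (k : α) (w : List (α × Bool)) :
    wordValue f ((k, false) :: w) = (f k)⁻¹ * wordValue f w := by simp [wordValue]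

theorem wordValue_invRev (w : List (α × Bool)) : wordValue f (invRev w) = (wordValue f w)⁻¹ := by
  simp [wordValue, ← inv_mk]

theorem wordValue_inv_flip (w : List (α × Bool)) :
    wordValue f⁻¹ (w.map fun x => (x.1, !x.2)) = wordValue f w := by
  induction w with
  | nil => simp
  | cons c w ih =>
    rcases c with ⟨k, b⟩
    cases b <;> simp [wordValue_cons_true, wordValue_cons_false, ih]

theorem mk_flip_eq_one {w : List (α × Bool)} (h : mk w = 1) :
    mk (w.map fun x => (x.1, !x.2)) = 1 := by
  have h1 := wordValue_inv_flip (fun k : α => (of k)⁻¹) w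
  have h2 : wordValue (fun k : α => (of k)⁻¹) w = 1 := by rw [wordValue, h, _root_.map_one]
  have h3 : (fun k : α => (of k)⁻¹)⁻¹ = of := by ext; simp
  rw [h2, h3, wordValue, lift_of_eq_id] at h1
  exact h1

end wordValue

/-- A shortest word among those that are nontrivial in the free group and have value `1`. -/
structure IsShortestLoop (f : α → G) (w : List (α × Bool)) : Prop where
  value : wordValue f w = 1
  ne_one : mk w ≠ 1
  length_le : ∀ w', wordValue f w' = 1 → mk w' ≠ 1 → w.length ≤ w'.length

namespace IsShortestLoop

variable {f : α → G} {w u v : List (α × Bool)}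

theorem eq_one_of_length_lt (h : IsShortestLoop f w) (hv : wordValue f v = 1)
    (hl : v.length < w.length) : FreeGroup.mk v = 1 := by
  by_contra hne
  exact absurd (h.length_le v hv hne) (by omega)

theorem rotate (h : IsShortestLoop f (u ++ v)) : IsShortestLoop f (v ++ u) where
  value := by
    have := h.value
    rw [wordValue_append] at this ⊢
    exact mul_eq_one_comm.1 this
  ne_one := by
    have := h.ne_one
    rw [← mul_mk] at this ⊢
    exact fun e => this (mul_eq_one_comm.1 e)
  length_le w' h1 h2 := by
    have := h.length_le w' h1 h2
    simp only [List.length_append] at this ⊢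
    omega

theorem inverse (h : IsShortestLoop f w) : IsShortestLoop f (FreeGroup.invRev w) where
  value := by rw [wordValue_invRev, h.value, inv_one]
  ne_one := by rw [← inv_mk]; exact inv_ne_one.2 h.ne_one
  length_le w' h1 h2 := by rw [invRev_length]; exact h.length_le w' h1 h2

theorem flip (h : IsShortestLoop f w) :
    IsShortestLoop f⁻¹ (w.map fun x => (x.1, !x.2)) where
  value := by rw [wordValue_inv_flip, h.value]
  ne_one e := h.ne_one (by simpa [Function.comp_def] using mk_flip_eq_one e)
  length_le w' h1 h2 := by
    have := h.length_le (w'.map fun x => (x.1, !x.2))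
      (by rw [← wordValue_inv_flip]; simpa [Function.comp_def] using h1)
      (fun e => h2 (by simpa [Function.comp_def] using mk_flip_eq_one e))
    simpa using this

theorem isReduced (h : IsShortestLoop f w) : IsReduced w := by
  classical
  rw [isReduced_iff_reduce_eq]
  have hred : Red w (reduce w) := reduce.red
  refine hred.sublist.eq_of_length_le (h.length_le _ ?_ ?_)
  · rw [wordValue, reduce.self]; exact h.value
  · rw [reduce.self]; exact h.ne_one

theorem not_cancel {k : α} {b : Bool}
    (h : IsShortestLoop f (u ++ (k, b) :: (k, !b) :: v)) : False := by
  have h' : IsReduced ([(k, b), (k, !b)] : List (α × Bool)) :=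
    h.isReduced.infix ⟨u, v, by simp⟩
  simp at h'

end IsShortestLoop

theorem exists_isShortestLoop (f : α → G) (hf : ¬ Function.Injective (lift f)) :
    ∃ w, IsShortestLoop f w := by
  classical
  have hex : ∃ n, ∃ w : List (α × Bool), w.length = n ∧ wordValue f w = 1 ∧ mk w ≠ 1 := by
    rw [injective_iff_map_eq_one] at hf
    push Not at hf
    obtain ⟨x, hx, hx1⟩ := hf
    exact ⟨_, x.toWord, rfl, by rwa [wordValue, mk_toWord], by rwa [mk_toWord]⟩
  obtain ⟨w, hw, h1, h2⟩ := Nat.find_spec hex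
  exact ⟨w, h1, h2, fun w' h1' h2' => hw ▸ Nat.find_min' hex ⟨w', rfl, h1', h2'⟩⟩

theorem IsReduced.eq_of_mk_eq {u v : List (α × Bool)} (hu : IsReduced u) (hv : IsReduced v)
    (h : mk u = mk v) : u = v := by
  classical
  rw [← hu.reduce_eq, ← hv.reduce_eq]
  exact reduce.sound h

end FreeGroup

/-! ### How a shortest loop crosses the cut -/

/-- A subset `E` with exactly one incoming edge, ending at `p k`, for each generator `f k`, and no
outgoing edges, in the graph with edges `x → f k * x`. -/
structure IsEdgeCut {α G : Type*} [Group G] (f p : α → G) (E : Set G) : Prop where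
  mem : ∀ k, p k ∈ E
  mem_iff : ∀ k x, x ∈ E ↔ f k * x ∈ E ∧ f k * x ≠ p k

namespace IsEdgeCut

open FreeGroup

variable {α G : Type*} [Group G] {f p : α → G} {E : Set G}

/-- Reversing all edges exchanges inside and outside; this is the symmetry between the two arcs of a
loop. -/
theorem compl (hE : IsEdgeCut f p E) : IsEdgeCut f⁻¹ (fun k => (f k)⁻¹ * p k) Eᶜ where
  mem k h := ((hE.mem_iff k _).1 h).2 (mul_inv_cancel_left _ _)
  mem_iff k x := by
    have h1 := hE.mem_iff k ((f k)⁻¹ * x)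
    have h2 := hE.mem k
    rw [mul_inv_cancel_left] at h1
    simp only [Pi.inv_apply, Set.mem_compl_iff, h1, ne_eq, mul_right_inj]
    constructor
    · exact fun hx => ⟨fun h => hx h.1, fun e => hx (e ▸ h2)⟩
    · exact fun hx hx' => hx.1 ⟨hx', hx.2⟩

/-- Words act from right to left. All boundary edges point inwards, so a path can leave `E` only by
running one of them backwards. -/
theorem exists_exit (hE : IsEdgeCut f p E) {x : G} (hx : x ∈ E) :
    ∀ w, wordValue f w * x ∉ E → ∃ z k u, w = z ++ (k, false) :: u ∧ wordValue f u * x = p k := by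
  intro w
  induction w with
  | nil => intro h; simp [hx] at h
  | cons c w ih =>
    intro h
    by_cases hw : wordValue f w * x ∈ E
    · obtain ⟨k, b⟩ := c
      cases b with
      | true =>
        rw [wordValue_cons_true, mul_assoc] at h
        exact absurd ((hE.mem_iff k _).1 hw).1 h
      | false =>
        refine ⟨[], k, w, rfl, ?_⟩
        by_contra hne
        rw [wordValue_cons_false, mul_assoc] at h
        exact h ((hE.mem_iff k _).2 (by rw [mul_inv_cancel_left]; exact ⟨hw, hne⟩))
    · obtain ⟨z, k, u, rfl, hu⟩ := ih hw
      exact ⟨c :: z, k, u, rfl, hu⟩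

/-- A shortest loop that enters `E` at `p i` leaves it at some other `p j`. -/
theorem exists_split (hE : IsEdgeCut f p E) {i j : α} (hk : ∀ k, k = i ∨ k = j)
    {w : List (α × Bool)} (hw : IsShortestLoop f (w ++ [(i, true)])) :
    ∃ z u, w = z ++ (j, false) :: u ∧ wordValue f u * p i = p j := by
  have hval : wordValue f w = (f i)⁻¹ := by
    have := hw.value
    rw [wordValue_append, wordValue_cons_true, wordValue_nil, mul_one] at this
    exact eq_inv_of_mul_eq_one_left this
  obtain ⟨z, k, u, rfl, hu⟩ := hE.exists_exit (hE.mem i) w (by rw [hval]; exact hE.compl.mem i)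
  rcases hk k with rfl | rfl
  -- Leaving through the entry edge would make `u` a shorter loop, hence trivial in the free group;
  -- the two crossings then cancel and `z` is a shorter nontrivial relation.
  · exfalso
    have hu1 : wordValue f u = 1 := by simpa using hu
    have hmk : FreeGroup.mk u = 1 := hw.eq_one_of_length_lt hu1 (by simp; omega)
    have hz : FreeGroup.mk (z ++ (k, false) :: u ++ [(k, true)]) = FreeGroup.mk z := by
      have e : z ++ (k, false) :: u ++ [(k, true)] = z ++ ([(k, false)] ++ (u ++ [(k, true)])) := by
        simp
      rw [e, ← mul_mk, ← mul_mk, ← mul_mk, hmk, one_mul, mul_mk (L₁ := [(k, false)])]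
      have h1 : FreeGroup.mk ([(k, false)] ++ [(k, true)]) = 1 := by
        rw [← mul_mk]
        exact inv_mul_cancel (of k)
      rw [h1, mul_one]
    have hzv : wordValue f z = 1 := by rw [wordValue, ← hz]; exact hw.value
    exact hw.ne_one (hz.trans (hw.eq_one_of_length_lt hzv (by simp)))
  · exact ⟨z, u, rfl, hu⟩

end IsEdgeCut

/-! ### Uniqueness and periodicity of arcs -/

namespace FreeGroup

variable {α G : Type*} [Group G] {f : α → G}

/-- Splicing a shorter `u'` in place of `u` would give a shorter relation. It is still reduced,
because its two pieces overlap in the letter `(j, false)`, so it is not trivial. -/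
theorem IsShortestLoop.length_arc_le {i j : α} {z u z' u' : List (α × Bool)}
    (h : IsShortestLoop f (z ++ (j, false) :: u ++ [(i, true)]))
    (h' : IsShortestLoop f (z' ++ (j, false) :: u' ++ [(i, true)]))
    (hu : wordValue f u = wordValue f u') : u.length ≤ u'.length := by
  by_contra hlt
  have hval : wordValue f (z ++ (j, false) :: u' ++ [(i, true)]) = 1 := by
    rw [← h.value]
    simp only [wordValue_append, wordValue_cons_false, hu]
  have hone := h.eq_one_of_length_lt hval (by simp; omega)
  have hred : IsReduced (z ++ [(j, false)] ++ (u' ++ [(i, true)])) :=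
    IsReduced.append_overlap (h.isReduced.infix ⟨[], u ++ [(i, true)], by simp⟩)
      (h'.isReduced.infix ⟨z', [], by simp⟩) (by simp)
  have := hred.eq_of_mk_eq (v := []) .nil (by rw [← one_eq_mk, ← hone]; simp)
  simp at this

/-- Since `u` is at most as long as `z`, the relation `u' * u⁻¹` is shorter than the loop, hence
trivial in the free group. -/
theorem IsShortestLoop.arc_unique {i j : α} {z u z' u' : List (α × Bool)}
    (h : IsShortestLoop f (z ++ (j, false) :: u ++ [(i, true)]))
    (h' : IsShortestLoop f (z' ++ (j, false) :: u' ++ [(i, true)]))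
    (hu : wordValue f u = wordValue f u') (hle : u.length ≤ z.length) : u' = u := by
  have hlen := le_antisymm (h.length_arc_le h' hu) (h'.length_arc_le h hu.symm)
  refine (h'.isReduced.infix ⟨z' ++ [(j, false)], [(i, true)], by simp⟩).eq_of_mk_eq
    (h.isReduced.infix ⟨z ++ [(j, false)], [(i, true)], by simp⟩) ?_
  have hone : FreeGroup.mk (u' ++ FreeGroup.invRev u) = 1 := h.eq_one_of_length_lt
    (by rw [wordValue_append, wordValue_invRev, hu, mul_inv_cancel])
    (by simp only [List.length_append, invRev_length, List.length_cons]; omega)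
  rw [← mul_mk, ← inv_mk] at hone
  exact mul_inv_eq_one.1 hone

/-- Literal commutation with a two-letter block lets that block be peeled off the front repeatedly;
the opposite signs rule out odd length. -/
theorem wordValue_eq_pow_of_commute {i j : α} : ∀ w : List (α × Bool),
    (i, true) :: (j, false) :: w = w ++ [(i, true), (j, false)] →
    ∃ n : ℕ, wordValue f w = (f i * (f j)⁻¹) ^ n
  | [], _ => ⟨0, by simp⟩
  | [y], h => by simp at h
  | y :: y' :: w, h => by
    simp only [List.cons_append, List.cons.injEq] at h
    obtain ⟨rfl, rfl, h⟩ := h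
    obtain ⟨n, hn⟩ := wordValue_eq_pow_of_commute w h
    exact ⟨n + 1, by
      rw [wordValue_cons_true, wordValue_cons_false, hn, pow_succ', mul_assoc]⟩

end FreeGroup

/-! ### The arc is a power of `f i * (f j)⁻¹` -/

namespace IsEdgeCut

open FreeGroup

variable {α G : Type*} [Group G] {f p : α → G} {E : Set G}

/-- By uniqueness, after any letter `(i, true)` of a shortest loop one must read `U` and then `(j,
false)`; after `(j, true)`, the inverse of `U` and then `(i, false)`. Applying this to rotations and
inverses of the loop eliminates every shape of `U` except a power of the block `(i, true), (j,
false)`. -/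
theorem exists_zpow_of_length_le (hE : IsEdgeCut f p E) {i j : α} (hk : ∀ k, k = i ∨ k = j)
    (hij : i ≠ j) (hp : p i ≠ p j) {z U : List (α × Bool)}
    (hw : IsShortestLoop f (z ++ (j, false) :: U ++ [(i, true)]))
    (hU : wordValue f U * p i = p j) (hle : U.length ≤ z.length) :
    ∃ n : ℤ, (f i * (f j)⁻¹) ^ n * p i = p j := by
  have key : ∀ {z' u'}, IsShortestLoop f (z' ++ (j, false) :: u' ++ [(i, true)]) →
      wordValue f u' * p i = p j → u' = U := fun h hu =>
    hw.arc_unique h (mul_right_cancel (hU.trans hu.symm)) hle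
  have fwd : ∀ {w}, IsShortestLoop f (w ++ [(i, true)]) → ∃ z', w = z' ++ (j, false) :: U := by
    intro w h
    obtain ⟨z', u', rfl, hu⟩ := hE.exists_split hk h
    exact ⟨z', by rw [key h hu]⟩
  have bwd : ∀ {w}, IsShortestLoop f (w ++ [(j, true)]) →
      ∃ z', w = z' ++ (i, false) :: invRev U := by
    intro w h
    obtain ⟨z', u', rfl, hu⟩ := hE.exists_split (fun k => (hk k).symm) h
    have h2 : IsShortestLoop f (invRev z' ++ (j, false) :: invRev u' ++ [(i, true)]) := by
      have h1 : IsShortestLoop f (((j, false) :: invRev u' ++ [(i, true)]) ++ invRev z') := by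
        simpa [invRev] using h.inverse
      simpa using h1.rotate
    have := key h2 (by rw [wordValue_invRev, ← hu, inv_mul_cancel_left])
    exact ⟨z', by rw [← this, invRev_invRev]⟩
  rcases List.eq_nil_or_concat' U with rfl | ⟨U', ⟨k, b⟩, rfl⟩
  · exact absurd (by simpa using hU) hp
  rcases hk k with rfl | rfl
  · exfalso
    cases b with
    | false =>
      exact IsShortestLoop.not_cancel (u := z ++ (j, false) :: U') (v := [])
        (k := k) (b := false) (by simpa using hw)
    | true =>
      have h1 : IsShortestLoop f (((k, true) :: z ++ (j, false) :: U') ++ [(k, true)]) := by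
        have : IsShortestLoop f ((z ++ (j, false) :: U' ++ [(k, true)]) ++ [(k, true)]) := by
          simpa using hw
        simpa using this.rotate
      obtain ⟨z', hz'⟩ := fwd h1
      have h2 : (j, false) :: U' = U' ++ [(k, true)] :=
        (List.append_inj' (s₁ := (k, true) :: z) (s₂ := z' ++ [(j, false)]) (by simpa using hz') (by simp)).2
      classical
      have := congrArg (List.count (k, true)) h2
      simp at this
  · cases b with
    | true =>
      exfalso
      have h1 : IsShortestLoop f (((i, true) :: z ++ (k, false) :: U') ++ [(k, true)]) := by
        have : IsShortestLoop f ((z ++ (k, false) :: U' ++ [(k, true)]) ++ [(i, true)]) := by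
          simpa using hw
        simpa using this.rotate
      obtain ⟨z', hz'⟩ := bwd h1
      have h2 : (k, false) :: U' = invRev (U' ++ [(k, true)]) :=
        (List.append_inj' (s₁ := (i, true) :: z) (s₂ := z' ++ [(i, false)])
          (by simpa using hz') (by simp [invRev])).2
      -- A word equal to its own formal inverse is trivial, since free groups have no 2-torsion.
      have h3 : U' = invRev U' := by simpa [invRev] using h2
      have h4 : FreeGroup.mk U' = 1 := by
        have : FreeGroup.mk U' = (FreeGroup.mk U')⁻¹ := by rw [inv_mk, ← h3]
        exact self_eq_inv.1 this
      have hred : IsReduced U' := hw.isReduced.infix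
        ⟨z ++ [(k, false)], [(k, true), (i, true)], by simp⟩
      obtain rfl := hred.eq_of_mk_eq (v := []) .nil (by rw [h4, one_eq_mk])
      exact IsShortestLoop.not_cancel (u := z) (v := [(i, true)])
        (k := k) (b := false) (by simpa using hw)
    | false =>
      -- the word `U` begins with the letter `i`
      obtain ⟨V, hV⟩ : ∃ V, U' ++ [(k, false)] = (i, true) :: V := by
        have h1 : IsShortestLoop f
            ((invRev U' ++ (k, true) :: invRev z ++ [(i, false)]) ++ [(k, true)]) := by
          have : IsShortestLoop f
              ([(i, false), (k, true)] ++ (invRev U' ++ (k, true) :: invRev z)) := by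
            simpa [invRev] using hw.inverse
          simpa using this.rotate
        obtain ⟨z', hz'⟩ := bwd h1
        rcases hc : U' ++ [(k, false)] with _ | ⟨⟨k', b'⟩, V⟩
        · simp at hc
        · rw [hc, invRev_cons] at hz'
          have := (List.append_inj' (s₁ := invRev U' ++ (k, true) :: invRev z)
            (t₁ := [(i, false)]) (s₂ := z' ++ (i, false) :: invRev V) (t₂ := [(k', !b')])
            (by simpa [invRev] using hz') rfl).2
          simp at this
          obtain ⟨rfl, rfl⟩ := this
          exact ⟨V, rfl⟩
      rcases List.eq_nil_or_concat' U' with rfl | ⟨U'', ⟨d, b⟩, rfl⟩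
      · simp [hij.symm] at hV
      rcases hk d with rfl | rfl
      · cases b with
        | false =>
          exfalso
          have h1 : IsShortestLoop f
              ((invRev U'' ++ (k, true) :: invRev z ++ [(d, false)] ++ [(k, true)])
                ++ [(d, true)]) := by
            have : IsShortestLoop f
                ([(d, false), (k, true), (d, true)] ++ (invRev U'' ++ (k, true) :: invRev z)) := by
              simpa [invRev] using hw.inverse
            simpa using this.rotate
          obtain ⟨z', hz'⟩ := fwd h1
          have := (List.append_inj' (s₁ := invRev U'' ++ (k, true) :: invRev z ++ [(d, false)])
            (t₁ := [(k, true)]) (s₂ := z' ++ (k, false) :: (U'' ++ [(d, false)]))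
            (t₂ := [(k, false)]) (by simpa using hz') rfl).2
          simp at this
        | true =>
          have h1 : IsShortestLoop f
              (([(k, false), (d, true)] ++ z ++ (k, false) :: U'') ++ [(d, true)]) := by
            have : IsShortestLoop f ((z ++ (k, false) :: U'' ++ [(d, true)]) ++
                [(k, false), (d, true)]) := by simpa using hw
            simpa using this.rotate
          obtain ⟨z', hz'⟩ := fwd h1
          have hlen := congrArg List.length hV
          have h2 : (k, false) :: U'' = V := (List.append_inj'
            (s₁ := (k, false) :: (d, true) :: z) (s₂ := z' ++ [(k, false), (d, true)]) (t₂ := V)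
            (by rw [hV] at hz'; simpa using hz') (by simp at hlen ⊢; omega)).2
          -- Both ends of `U` are now known, and `h2` says that `U''` commutes with the block as a
          -- word.
          obtain ⟨n, hn⟩ := wordValue_eq_pow_of_commute (f := f) (i := d) (j := k) U''
            (by rw [h2, ← hV]; simp)
          refine ⟨n + 1, ?_⟩
          rw [← hU, ← hV.symm, ← h2, wordValue_cons_true, wordValue_cons_false, hn]
          rw [add_comm, zpow_one_add, zpow_natCast, mul_assoc (f d)]
      · exfalso
        cases b with
        | true =>
          exact IsShortestLoop.not_cancel (u := z ++ (d, false) :: U'') (v := [(i, true)])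
            (k := d) (b := true) (by simpa using hw)
        | false =>
          have h1 : IsShortestLoop f
              ((invRev U'' ++ (d, true) :: invRev z ++ [(i, false)] ++ [(d, true)])
                ++ [(d, true)]) := by
            have : IsShortestLoop f
                ([(i, false), (d, true), (d, true)] ++ (invRev U'' ++ (d, true) :: invRev z)) := by
              simpa [invRev] using hw.inverse
            simpa using this.rotate
          obtain ⟨z', hz'⟩ := bwd h1
          rw [hV, invRev_cons] at hz'
          have := (List.append_inj' (s₁ := invRev U'' ++ (d, true) :: invRev z ++ [(i, false)])
            (t₁ := [(d, true)]) (s₂ := z' ++ (i, false) :: invRev V) (t₂ := [(i, false)])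
            (by simpa [invRev] using hz') rfl).2
          simp at this

theorem exists_zpow (hE : IsEdgeCut f p E) {i j : α} (hk : ∀ k, k = i ∨ k = j)
    (hij : i ≠ j) (hp : p i ≠ p j) {w : List (α × Bool)}
    (hw : IsShortestLoop f (w ++ [(i, true)])) :
    ∃ n : ℤ, (f i * (f j)⁻¹) ^ n * p i = p j := by
  obtain ⟨z, U, rfl, hU⟩ := hE.exists_split hk hw
  rcases le_total U.length z.length with hle | hle
  · exact hE.exists_zpow_of_length_le hk hij hp hw hU hle
  -- Here the outer arc `z` is the shorter one, so the complementary cut is used. It needs distinct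
  -- base points; if they coincide, the exponent `-1` already works.
  by_cases hp' : (f j)⁻¹ * p j = (f i)⁻¹ * p i
  · refine ⟨-1, ?_⟩
    rw [zpow_neg_one, mul_inv_rev, inv_inv, mul_assoc, ← hp', mul_inv_cancel_left]
  have hval : wordValue f z * ((f j)⁻¹ * p j) = (f i)⁻¹ * p i := by
    have := hw.value
    simp only [wordValue_append, wordValue_cons_false, wordValue_cons_true, wordValue_nil,
      mul_one] at this
    rw [← eq_inv_of_mul_eq_one_left this, ← hU]
    simp only [mul_assoc]
  let φ : α × Bool → α × Bool := fun x => (x.1, !x.2)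
  have hflip : IsShortestLoop f⁻¹ (U.map φ ++ (i, false) :: z.map φ ++ [(j, true)]) := by
    have h1 : IsShortestLoop f⁻¹ ((z.map φ ++ [(j, true)]) ++ (U.map φ ++ [(i, false)])) := by
      simpa [φ] using hw.flip
    simpa using h1.rotate
  obtain ⟨n, hn⟩ := hE.compl.exists_zpow_of_length_le (fun k => (hk k).symm) hij.symm hp' hflip
    (by rw [wordValue_inv_flip]; exact hval) (by simpa using hle)
  refine ⟨-(n + 1), ?_⟩
  simp only [Pi.inv_apply, inv_inv] at hn
  have hconj : ((f j)⁻¹ * f i) ^ n = (f i)⁻¹ * (f i * (f j)⁻¹) ^ n * f i := by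
    have := conj_zpow (i := n) (a := (f i)⁻¹) (b := f i * (f j)⁻¹)
    rw [inv_inv] at this
    rw [← this]
    congr 1
    group
  rw [hconj] at hn
  have : (f i * (f j)⁻¹) ^ (n + 1) * p j = p i := by
    rw [zpow_add_one]
    simpa [mul_assoc] using hn
  rw [← this, ← mul_assoc, ← zpow_add]
  simp

end IsEdgeCut

/-! ### Conclusion -/

theorem IsWeakSierpinskiWith.isFreePair_conj {G : Type*} [Group G] {g h : G} {E : Set G}
    (hE : IsWeakSierpinskiWith g h E) : IsFreePair g (h⁻¹ * g * h) := by
  obtain ⟨a, ha, b, hb, hab, hg, hh⟩ := hE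
  have mem_iff : ∀ {c d : G}, c • E = E \ {d} → ∀ x, x ∈ E ↔ c * x ∈ E ∧ c * x ≠ d := by
    intro c d hc x
    rw [← Set.smul_mem_smul_set_iff (a := c), hc]
    rfl
  by_cases hfree : IsFreePair g h
  · exact hfree.conj
  have hcut : IsEdgeCut (![g, h] : Fin 2 → G) ![a, b] E :=
    ⟨fun k => by fin_cases k <;> assumption,
      fun k => by fin_cases k <;> [exact mem_iff hg; exact mem_iff hh]⟩
  suffices ∃ n : ℤ, (g * h⁻¹) ^ n * a = b by
    obtain ⟨n, hn⟩ := this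
    exact isFreePair_conj_of_mem_orbit ha hb hab (mem_iff hg) (mem_iff hh) hn
  obtain ⟨w, hw⟩ := FreeGroup.exists_isShortestLoop _ hfree
  -- Inverting and rotating if necessary, the loop may be taken to start along a generator in the
  -- positive direction.
  obtain ⟨k, w', hw'⟩ : ∃ k w', FreeGroup.IsShortestLoop (![g, h] : Fin 2 → G)
      (w' ++ [(k, true)]) := by
    rcases List.eq_nil_or_concat' w with rfl | ⟨w', ⟨k, b⟩, rfl⟩
    · exact absurd rfl hw.ne_one
    cases b with
    | true => exact ⟨k, w', hw⟩
    | false =>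
      have h1 : FreeGroup.IsShortestLoop (![g, h] : Fin 2 → G)
          ([(k, true)] ++ FreeGroup.invRev w') := by
        simpa [FreeGroup.invRev] using hw.inverse
      exact ⟨k, _, h1.rotate⟩
  fin_cases k
  · exact hcut.exists_zpow (i := 0) (j := 1) (by decide) (by decide) hab hw'
  · obtain ⟨n, hn⟩ := hcut.exists_zpow (i := 1) (j := 0) (by decide) (by decide) hab.symm hw'
    refine ⟨n, ?_⟩
    have hn : (h * g⁻¹) ^ n * b = a := hn
    rw [← hn, show h * g⁻¹ = (g * h⁻¹)⁻¹ by group, inv_zpow, mul_inv_cancel_left]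

theorem corollary1 {G : Type*} [Group G] :
    ((∃ E : Set G, IsWeakSierpinski E) → ∃ F : Subgroup G, IsFreeOfRankTwo F) ∧
    (∀ (g h : G) (E : Set G), IsWeakSierpinskiWith g h E →
      IsFreePair (fstGen g h) ((sndGen g h)⁻¹ * fstGen g h * sndGen g h)) := by
  refine ⟨?_, fun g h E hE => ?_⟩
  · rintro ⟨E, g, h, hE⟩
    exact ⟨_, ⟨(MonoidHom.ofInjective hE.isFreePair_conj).symm⟩⟩
  · exact isFreePair_of_map (Subgroup.closure ({g, h} : Set G)).subtype hE.isFreePair_conj
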